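/- **Setting.** Let $\Pi$ be a finite set of processes, $F\subseteq\Pi$ the set of Byzantine processes, $C=\Pi\setminus F$ the set of correct processes, and $f\in\mathbb N$ the fault threshold, known to all processes, with $|F|\le f$. Every process $i$ has a participant detector $\mathit{PD}_i\subseteq\Pi$. The knowledge connectivity graph $G_{di}$ has node set $\Pi$ and an edge $(i,j)$ iff $j\in \mathit{PD}_i$; its safe subgraph $G_{safe}$ is the subgraph induced by $C$. Paths with the same end points are node-disjoint if they are distinct and share no other nodes. A directed graph is $k$-strongly connected if it has more than $k$ nodes and there are at least $k$ node-disjoint paths from $i$ to $j$ for all nodes $i\ne j$; $\kappa$ denotes the largest such $k$ ($0$ if there is none). For non-empty $A,B$, write $A\Rightarrow^{>k}B$ if there are more than $k$ node-disjoint paths from every member of $A$ to every member of $B$. A sink component is a strongly connected component that no path leaves. Write $G_{di}\in\mathcal G_{di}$ if (i) the undirected graph underlying $G_{safe}$ is connected; (ii) $G_{safe}$ has exactly one sink component $V_{sink}$; (iii) the subgraph induced by $V_{sink}$ is $(f+1)$-strongly connected; (iv) in $G_{safe}$ there are at least $f+1$ node-disjoint paths from every $i\in C\setminus V_{sink}$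 to every $j\in V_{sink}$; and (v) $|V_{sink}|\ge 2f+1$. **Algorithm of a correct process $i$.** *Discovery.* Initially $\mathcal S_{PD}=\{\langle i,\mathit{PD}_i\rangle_i\}$ (the subscript is the signer), $\mathcal S_{known}=\mathit{PD}_i\cup\{i\}$, $\mathcal S_{received}=\{i\}$. Periodically, $i$ sends $\langle\mathrm{GetPDs}\rangle$ to all members of $\mathcal S_{known}$. Upon receiving $\langle\mathrm{GetPDs}\rangle$ from $j$, it sends $\langle\mathrm{SetPDs},\mathcal S_{PD}\rangle$ to $j$. Upon receiving $\langle\mathrm{SetPDs},X\rangle$ from $j$, if $X$ contains a record of $j$'s PD signed by $j$, it adds $X$ to $\mathcal S_{PD}$, all members of PDs in $X$ that are signed by their owners to $\mathcal S_{known}$, and the owners of those PDs to $\mathcal S_{received}$. *Sink.* The function $\mathtt{sink}()$ starts Discovery, which keeps running concurrently, and waits until there is $R\subseteq\mathcal S_{received}$ such that $\kappa(R)\ge f+1$ and every $K\subseteq(\mathcal S_{known}\cup\mathcal S_{received})\setminus R$ with $R\Rightarrow^{>f}K$ satisfies $|K|\le f$. Here $\kappa(R)$ (for the subgraph induced by $R$)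 and $\Rightarrow$ refer to the graph on $\mathcal S_{known}\cup\mathcal S_{received}$ whose edges are given by the PDs in $\mathcal S_{PD}$ that are signed by their owners. It then returns $K\cup R$ for some $K\subseteq(\mathcal S_{known}\cup\mathcal S_{received})\setminus R$ with $R\Rightarrow^{>f}K$ if such a $K$ exists, and $R$ otherwise. **Executions.** All correct processes run this algorithm from time $0$. Byzantine processes may send arbitrary messages at any time to any process, but cannot forge signatures of correct processes, so the only record signed by a correct process $j$ is $\langle j,\mathit{PD}_j\rangle_j$; the receiver of a message knows its true sender. Channels are reliable, and the system is partially synchronous: in every execution there are a time $\mathrm{GST}$ and a $\delta>0$ such that every message sent at time $s$ between correct processes is delivered by time $\max(s,\mathrm{GST})+\delta$. Only finitely many events happen in bounded time, and a correct process whose waiting condition holds permanently from some moment on does not wait forever. **Theorem.** If $G_{di}\in\mathcal G_{di}$, then in every such execution the call $\mathtt{sink}()$ of every correct process eventually terminates (returns a set). -/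

import Mathlib

namespace BFTCUP

/-! ### Directed graphs

For `G : Digraph P` and `V : Finset P`, notions "in `(G, V)`" refer to the subgraph of `G` that is
induced by the node set `V`. -/

section Graphs

variable {P : Type*}

/-- `l` lists the nodes of a simple directed path from `u` to `v` in the subgraph of `G` induced
by `V`. -/
def IsPathIn (G : Digraph P) (V : Finset P) (u v : P) (l : List P) : Prop :=
  l.Nodup ∧ l.head? = some u ∧ l.getLast? = some v ∧ l.IsChain G.Adj ∧ ∀ x ∈ l, x ∈ V

/-- In the subgraph of `G` induced by `V`, the node `u` can reach `v` through at least `k`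
(internally) node-disjoint paths. -/
def DisjointPathsIn (G : Digraph P) (V : Finset P) (k : ℕ) (u v : P) : Prop :=
  ∃ L : Finset (List P), k ≤ L.card ∧ (∀ l ∈ L, IsPathIn G V u v l) ∧
    ∀ l ∈ L, ∀ m ∈ L, l ≠ m → ∀ x, x ∈ l → x ∈ m → x = u ∨ x = v

/-- The subgraph of `G` induced by `V` is `k`-strongly connected: any two nodes are joined by `k`
node-disjoint paths. As usual for connectivity, more than `k` nodes are required; this only
matters for graphs with at most one node. -/
def IsKStronglyConnected (G : Digraph P) (V : Finset P) (k : ℕ) : Prop :=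
  k < V.card ∧ ∀ i ∈ V, ∀ j ∈ V, i ≠ j → DisjointPathsIn G V k i j

/-- The strong connectivity `κ` of the subgraph of `G` induced by `V`. -/
noncomputable def strongConnectivity (G : Digraph P) (V : Finset P) : ℕ :=
  sSup {k | IsKStronglyConnected G V k}

/-- In `(G, V)`, every member of `A` has more than `k` node-disjoint paths to every member of `B`,
where `A` and `B` are non-empty. -/
def ReachesMoreThan (G : Digraph P) (V : Finset P) (k : ℕ) (A B : Finset P) : Prop :=
  A.Nonempty ∧ B.Nonempty ∧ ∀ a ∈ A, ∀ b ∈ B, DisjointPathsIn G V (k + 1) a b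

/-- There is a directed path from `i` to `j` in `(G, V)`. -/
def ReachableIn (G : Digraph P) (V : Finset P) (i j : P) : Prop :=
  ∃ l, IsPathIn G V i j l

/-- `S` is the node set of a strongly connected component of `(G, V)`. -/
def IsStrongComponent (G : Digraph P) (V S : Finset P) : Prop :=
  S.Nonempty ∧ S ⊆ V ∧
    ∀ i ∈ S, ∀ j ∈ V, j ∈ S ↔ ReachableIn G V i j ∧ ReachableIn G V j i

/-- `S` is the node set of a sink component of `(G, V)`. -/
def IsSink (G : Digraph P) (V S : Finset P) : Prop :=
  IsStrongComponent G V S ∧ ∀ i ∈ S, ∀ j ∈ V, ReachableIn G V i j → j ∈ S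

/-- The subgraph of `G` induced by `V` belongs to `k`-OSR PD, with `S` the node set of its unique
sink component. -/
structure IsOSR (G : Digraph P) (V : Finset P) (k : ℕ) (S : Finset P) : Prop where
  connected : (SimpleGraph.fromRel fun a b : V => G.Adj a b).Connected
  isSink : IsSink G V S
  unique_sink : ∀ T, IsSink G V T → T = S
  sink_connected : IsKStronglyConnected G S k
  paths_to_sink : ∀ i ∈ V, i ∉ S → ∀ j ∈ S, DisjointPathsIn G V k i j

/-- The knowledge connectivity graph: `i → j` iff `j ∈ PD i`. -/
def knowledgeGraph (PD : P → Finset P) : Digraph P where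
  Adj i j := j ∈ PD i

/-- The knowledge connectivity graph of `PD`, with Byzantine set `F` and fault threshold `f`,
satisfies the requirements of the BFT-CUP model: its safe subgraph, induced by the non-Byzantine
processes, belongs to `(f+1)`-OSR PD and has a sink component with at least `2f+1` members. -/
def SatisfiesBFTCUP [Fintype P] [DecidableEq P]
    (PD : P → Finset P) (F : Finset P) (f : ℕ) : Prop :=
  ∃ S, IsOSR (knowledgeGraph PD) Fᶜ (f + 1) S ∧ 2 * f + 1 ≤ S.card

end Graphs

/-! ### Messages and local states -/

/-- The signed statement `⟨owner, pd⟩` with signature by `signer`. -/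
structure SignedPD (P : Type*) where
  owner : P
  pd : Finset P
  signer : P
deriving DecidableEq

/-- A record is well-signed if the alleged owner signed it. -/
def SignedPD.WellSigned {P : Type*} (r : SignedPD P) : Prop := r.signer = r.owner

instance {P : Type*} [DecidableEq P] : DecidablePred (SignedPD.WellSigned (P := P)) :=
  fun r => inferInstanceAs (Decidable (r.signer = r.owner))

/-- The two kinds of messages of the Discovery algorithm. -/
inductive Body (P : Type*) where
  | getPDs
  | setPDs (pds : Finset (SignedPD P))

/-- A message in transit, with its true sender (channels are authenticated) and sending time. -/
structure Packet (P : Type*) where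
  sentAt : ℝ
  src : P
  dst : P
  body : Body P

/-- The local variables of a process that executes `sink()` and the forked task `discovery()`;
`result` is the value returned by `sink()`, if it has returned. -/
structure LocalState (P : Type*) where
  pds : Finset (SignedPD P)
  known : Finset P
  received : Finset P
  result : Option (Finset P)

section Algorithms

variable {P : Type*} [DecidableEq P]

/-- The record `⟨i, PD_i⟩_i`. -/
def ownRecord (PD : P → Finset P) (i : P) : SignedPD P := ⟨i, PD i, i⟩

/-- Discovery: initial values of the local variables. -/
def LocalState.initial (PD : P → Finset P) (i : P) : LocalState P where
  pds := {ownRecord PD i}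
  known := insert i (PD i)
  received := {i}
  result := none

/-- Discovery: upon receiving `⟨SetPDs, pds⟩` from `j`. -/
noncomputable def LocalState.onSetPDs (s : LocalState P) (j : P) (pds : Finset (SignedPD P)) :
    LocalState P :=
  open Classical in
  if ∃ r ∈ pds, r.WellSigned ∧ r.owner = j then
    { s with
      pds := s.pds ∪ pds
      known := s.known ∪ (pds.filter SignedPD.WellSigned).biUnion SignedPD.pd
      received := s.received ∪ (pds.filter SignedPD.WellSigned).image SignedPD.owner }
  else s

/-- The processes that a process has heard of. -/
def LocalState.nodes (s : LocalState P) : Finset P := s.known ∪ s.received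

/-- The part of the knowledge connectivity graph that a process learned from well-signed PDs. -/
def LocalState.view (s : LocalState P) : Digraph P where
  Adj a b := ∃ r ∈ s.pds, r.WellSigned ∧ r.owner = a ∧ b ∈ r.pd

/-- `K ⊆ (known ∪ received) \ R` and `R` has more than `f` node-disjoint paths to `K`. -/
def LocalState.IsCandidate (s : LocalState P) (f : ℕ) (R K : Finset P) : Prop :=
  K ⊆ s.nodes \ R ∧ ReachesMoreThan s.view s.nodes f R K

/-- The set `R` satisfies the condition of the `wait until` line of the Sink algorithm. -/
def LocalState.IsWitness (s : LocalState P) (f : ℕ) (R : Finset P) : Prop :=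
  R ⊆ s.received ∧ f + 1 ≤ strongConnectivity s.view R ∧
    ∀ K, s.IsCandidate f R K → K.card ≤ f

/-- In state `s`, the `return` lines of the Sink algorithm may be reached and return `A`. -/
def LocalState.CanReturn (s : LocalState P) (f : ℕ) (A : Finset P) : Prop :=
  ∃ R, s.IsWitness f R ∧
    ((∃ K, s.IsCandidate f R K ∧ A = K ∪ R) ∨ ((¬ ∃ K, s.IsCandidate f R K) ∧ A = R))

/-! ### Executions -/

/-- A global configuration: the local states and the messages in transit. The local state of a
Byzantine process plays no role. -/
structure Config (P : Type*) where
  state : P → LocalState P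
  net : Multiset (Packet P)

/-- Names of events. -/
inductive Event (P : Type*) where
  /-- A correct process sends `GetPDs` to all processes it knows. -/
  | request (i : P)
  /-- A message is delivered. -/
  | deliver (p : Packet P)
  /-- A Byzantine process sends a message. -/
  | inject (p : Packet P)
  /-- The call `sink()` of a correct process returns. -/
  | finish (i : P) (A : Finset P)

/-- Signatures are unforgeable: a record signed by a correct process is the one record which that
process signs. -/
def Unforged (PD : P → Finset P) (F : Finset P) : Body P → Prop
  | .getPDs => True
  | .setPDs pds => ∀ r ∈ pds, r.signer ∉ F → r = ownRecord PD r.signer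

/-- `Step PD F f t c e c'`: the event `e` takes place at time `t` and leads from `c` to `c'`. -/
inductive Step (PD : P → Finset P) (F : Finset P) (f : ℕ) (t : ℝ) :
    Config P → Event P → Config P → Prop
  | request (c : Config P) (i : P) (hi : i ∉ F) :
      Step PD F f t c (.request i)
        ⟨c.state, c.net + (c.state i).known.val.map fun j => ⟨t, i, j, .getPDs⟩⟩
  | deliverGet (σ : P → LocalState P) (N : Multiset (Packet P)) (s : ℝ) (j i : P) (hi : i ∉ F) :
      Step PD F f t ⟨σ, ⟨s, j, i, .getPDs⟩ ::ₘ N⟩ (.deliver ⟨s, j, i, .getPDs⟩)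
        ⟨σ, ⟨t, i, j, .setPDs (σ i).pds⟩ ::ₘ N⟩
  | deliverSet (σ : P → LocalState P) (N : Multiset (Packet P)) (s : ℝ) (j i : P)
      (pds : Finset (SignedPD P)) (hi : i ∉ F) :
      Step PD F f t ⟨σ, ⟨s, j, i, .setPDs pds⟩ ::ₘ N⟩ (.deliver ⟨s, j, i, .setPDs pds⟩)
        ⟨Function.update σ i ((σ i).onSetPDs j pds), N⟩
  | deliverByzantine (σ : P → LocalState P) (N : Multiset (Packet P)) (p : Packet P)
      (hp : p.dst ∈ F) :
      Step PD F f t ⟨σ, p ::ₘ N⟩ (.deliver p) ⟨σ, N⟩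
  | inject (c : Config P) (b j : P) (m : Body P) (hb : b ∈ F) (hm : Unforged PD F m) :
      Step PD F f t c (.inject ⟨t, b, j, m⟩) ⟨c.state, ⟨t, b, j, m⟩ ::ₘ c.net⟩
  | finish (c : Config P) (i : P) (A : Finset P) (hi : i ∉ F) (hn : (c.state i).result = none)
      (hA : (c.state i).CanReturn f A) :
      Step PD F f t c (.finish i A)
        ⟨Function.update c.state i { c.state i with result := some A }, c.net⟩

/-- A partially synchronous execution in which all correct processes execute the Sink algorithm
with fault threshold `f`, while the processes in `F` are Byzantine. The `n`-th event takes place at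
time `time n` and leads from `config n` to `config (n + 1)`. -/
structure Execution (PD : P → Finset P) (F : Finset P) (f : ℕ) where
  config : ℕ → Config P
  event : ℕ → Event P
  time : ℕ → ℝ
  start : config 0 = ⟨LocalState.initial PD, 0⟩
  step : ∀ n, Step PD F f (time n) (config n) (event n) (config (n + 1))
  time_nonneg : 0 ≤ time 0
  time_mono : Monotone time
  time_unbounded : Filter.Tendsto time Filter.atTop Filter.atTop
  /-- Correct processes periodically send their requests. -/
  periodic : ∀ i ∉ F, ∃ T > 0, ∀ t ≥ 0, ∃ n, event n = .request i ∧ t ≤ time n ∧ time n ≤ t + T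
  /-- Channels are reliable and there are `GST` and `δ` such that no message between correct
  processes is in transit later than `δ` after `GST` and its sending time. -/
  partial_synchrony : ∃ GST δ : ℝ, 0 < δ ∧ ∀ n, ∀ p ∈ (config n).net,
    p.src ∉ F → p.dst ∉ F → time n ≤ max p.sentAt GST + δ
  /-- Weak fairness of `wait until`: no correct process waits forever although, from some moment
  on, the condition that it waits for holds all the time. -/
  progress : ∀ i ∉ F, ¬ ∃ N, ∀ n ≥ N,
    ((config n).state i).result = none ∧ ∃ R, ((config n).state i).IsWitness f R

end Algorithms

end BFTCUP

/-! The sink component `S` of the safe subgraph itself eventually satisfies the waiting condition at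
every correct process `i`, and then forever.

Discovery reaches `S`: once `i` holds the record of `a`, it knows the members of the PD of `a`. It
asks each of them directly, and a correct one answers with its own signed record. Induction along a
safe path from `i` yields the record of every member of `S` (`exists_ownRecord_mem_of_reachable`).

`S` is then a witness (`LocalState.Valid.isWitness`). The view contains all genuine edges inside
`S`, so connectivity carries over. Records of correct processes cannot be forged and no safe edge
leaves `S`, so every edge of the view that leaves `S` ends in `F`. Thus `F` cuts `S` off from other
correct nodes: at most `f` disjoint paths lead to such a node, and every candidate `K` lies inside
`F`. As records are never dropped, this persists, and fairness ends the wait. -/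

namespace BFTCUP

/-! ### Paths, cuts and sink components -/

section Graphs

variable {P : Type*}

/-- A chain from a member of `S` to a non-member of `S` contains an edge that leaves `S`. -/
theorem exists_adj_of_isChain {r : P → P → Prop} {S : Set P} :
    ∀ {l : List P} {u v : P}, l.head? = some u → l.getLast? = some v → l.IsChain r →
      u ∈ S → v ∉ S → ∃ x ∈ l, ∃ y ∈ l, r x y ∧ x ∈ S ∧ y ∉ S
  | [], _, _, hu, _, _, _, _ => by simp at hu
  | [a], u, v, hu, hv, _, huS, hvS => by
    simp only [List.head?_cons, Option.some.injEq, List.getLast?_singleton] at hu hv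
    subst hu hv
    exact absurd huS hvS
  | a :: b :: l, u, v, hu, hv, hl, huS, hvS => by
    simp only [List.head?_cons, Option.some.injEq] at hu
    subst hu
    rw [List.isChain_cons_cons] at hl
    by_cases hb : b ∈ S
    · obtain ⟨x, hx, y, hy, h⟩ := exists_adj_of_isChain (u := b) (v := v) rfl
        (by rwa [List.getLast?_cons_cons] at hv) hl.2 hb hvS
      exact ⟨x, List.mem_cons_of_mem _ hx, y, List.mem_cons_of_mem _ hy, h⟩
    · exact ⟨a, by simp, b, by simp, hl.1, huS, hb⟩

/-- A property that holds at the first node and is inherited along edges holds at the last node. -/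
theorem IsPathIn.induction {G : Digraph P} {V : Finset P} {u v : P} {l : List P}
    (h : IsPathIn G V u v l) {p : P → Prop} (hu : p u)
    (hp : ∀ a ∈ V, ∀ b ∈ V, p a → G.Adj a b → p b) : p v := by
  by_contra hv
  obtain ⟨-, h₁, h₂, h₃, h₄⟩ := h
  obtain ⟨x, hx, y, hy, hxy, hxp, hyp⟩ := exists_adj_of_isChain (S := {a | p a}) h₁ h₂ h₃ hu hv
  exact hyp (hp x (h₄ x hx) y (h₄ y hy) hxp hxy)

/-- Passing to a graph with more edges between the nodes in question keeps paths. -/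
theorem IsPathIn.mono {G H : Digraph P} {V : Finset P} {u v : P} {l : List P}
    (h : IsPathIn G V u v l) (hGH : ∀ a ∈ V, ∀ b ∈ V, G.Adj a b → H.Adj a b) :
    IsPathIn H V u v l := by
  obtain ⟨h₀, h₁, h₂, h₃, h₄⟩ := h
  refine ⟨h₀, h₁, h₂, ?_, h₄⟩
  rw [List.isChain_iff_getElem] at h₃ ⊢
  exact fun i hi => hGH _ (h₄ _ (List.getElem_mem _)) _ (h₄ _ (List.getElem_mem _)) (h₃ i hi)

theorem IsKStronglyConnected.mono {G H : Digraph P} {V : Finset P} {k : ℕ}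
    (h : IsKStronglyConnected G V k) (hGH : ∀ a ∈ V, ∀ b ∈ V, G.Adj a b → H.Adj a b) :
    IsKStronglyConnected H V k := by
  refine ⟨h.1, fun i hi j hj hij => ?_⟩
  obtain ⟨L, hL, hpath, hdisj⟩ := h.2 i hi j hj hij
  exact ⟨L, hL, fun l hl => (hpath l hl).mono hGH, hdisj⟩

theorem IsKStronglyConnected.le_strongConnectivity {G : Digraph P} {V : Finset P} {k : ℕ}
    (h : IsKStronglyConnected G V k) : k ≤ strongConnectivity G V :=
  -- The clause `k < V.card` bounds the set of admissible `k`; an unbounded set would have the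
  -- default supremum `0`.
  le_csSup ⟨V.card, fun _ hm => hm.1.le⟩ h

theorem IsPathIn.head_mem {G : Digraph P} {V : Finset P} {u v : P} {l : List P}
    (h : IsPathIn G V u v l) : u ∈ V :=
  h.2.2.2.2 u (List.mem_of_head? h.2.1)

/-- If all edges that leave `S` end in `F`, then there are at most `|F|` node-disjoint paths from
a member of `S` to a node outside of `S` and `F`. -/
theorem DisjointPathsIn.le_card_of_separates {G : Digraph P} {V : Finset P} {k : ℕ} {u v : P}
    (h : DisjointPathsIn G V k u v) {S F : Finset P} (hu : u ∈ S) (hvS : v ∉ S) (hvF : v ∉ F)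
    (hSF : ∀ a ∈ S, ∀ b ∉ S, G.Adj a b → b ∈ F) : k ≤ F.card := by
  obtain ⟨L, hL, hpath, hdisj⟩ := h
  have hex : ∀ l ∈ L, ∃ y ∈ l, y ∈ F ∧ y ∉ S := fun l hl => by
    obtain ⟨-, h₁, h₂, h₃, -⟩ := hpath l hl
    obtain ⟨x, -, y, hy, hxy, hxS, hyS⟩ :=
      exists_adj_of_isChain (S := (S : Set P)) h₁ h₂ h₃ (by simpa using hu) (by simpa using hvS)
    exact ⟨y, hy, hSF x (by simpa using hxS) y (by simpa using hyS) hxy, by simpa using hyS⟩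
  have : Nonempty P := ⟨u⟩
  choose! g hgl hgF hgS using hex
  -- Each path is sent to a node of `F` at which it leaves `S`. Two paths with the same image would
  -- share an inner node: it is not `u`, which lies in `S`, nor `v`, which avoids `F`.
  refine hL.trans (Finset.card_le_card_of_injOn g hgF fun l hl m hm hlm => ?_)
  by_contra hne
  rcases hdisj l hl m hm hne (g l) (hgl l hl) (hlm ▸ hgl m hm) with e | e
  · exact hgS l hl (e ▸ hu)
  · exact hvF (e ▸ hgF l hl)

/-- Every member of `V` reaches every member of the sink component. -/
theorem IsOSR.reachable {G : Digraph P} {V S : Finset P} {k : ℕ} (h : IsOSR G V (k + 1) S)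
    {i j : P} (hi : i ∈ V) (hj : j ∈ S) : ReachableIn G V i j := by
  obtain ⟨⟨-, hSV, hS⟩, -⟩ := h.isSink
  by_cases hiS : i ∈ S
  · exact ((hS i hiS j (hSV hj)).1 hj).1
  · obtain ⟨L, hL, hpath, -⟩ := h.paths_to_sink i hi hiS j hj
    obtain ⟨l, hl⟩ := Finset.card_pos.1 (k.succ_pos.trans_le hL)
    exact ⟨l, hpath l hl⟩

/-- No edge leaves a sink component. -/
theorem IsSink.mem_of_adj {G : Digraph P} {V S : Finset P} (h : IsSink G V S) {a b : P}
    (ha : a ∈ S) (hb : b ∈ V) (hab : G.Adj a b) : b ∈ S := by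
  -- A loop is treated apart because `[a, a]` is not a simple path.
  by_cases e : a = b
  · exact e ▸ ha
  · refine h.2 a ha b hb ⟨[a, b], by simpa using e, rfl, rfl, by simpa using hab, ?_⟩
    simpa using ⟨h.1.2.1 ha, hb⟩

end Graphs

/-! ### Invariants of local states, and the sink component as a witness -/

section LocalStates

variable {P : Type*} {PD : P → Finset P} {F : Finset P}

/-- The invariant of the local state of process `i`. -/
structure LocalState.Valid (PD : P → Finset P) (F : Finset P) (i : P) (s : LocalState P) :
    Prop where
  own : ownRecord PD i ∈ s.pds
  unforged : ∀ r ∈ s.pds, r.signer ∉ F → r = ownRecord PD r.signer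
  pd_subset : ∀ r ∈ s.pds, r.WellSigned → r.pd ⊆ s.known
  owner_mem : ∀ r ∈ s.pds, r.WellSigned → r.owner ∈ s.received

/-- In the view of a process, the outgoing edges of a correct process are genuine. -/
theorem LocalState.Valid.adj_of_view {i a b : P} {s : LocalState P} (h : s.Valid PD F i)
    (ha : a ∉ F) (hab : s.view.Adj a b) : (knowledgeGraph PD).Adj a b := by
  obtain ⟨r, hr, hw, rfl, hb⟩ := hab
  have hs : r.signer = r.owner := hw
  rw [h.unforged r hr (hs ▸ ha), hs] at hb
  exact hb

end LocalStates

section Algorithms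

variable {P : Type*} [DecidableEq P] {PD : P → Finset P} {F : Finset P} {f : ℕ}

theorem LocalState.valid_initial (i : P) : (LocalState.initial PD i).Valid PD F i where
  own := by simp [LocalState.initial]
  unforged r hr _ := by
    obtain rfl : r = ownRecord PD i := by simpa [LocalState.initial] using hr
    rfl
  pd_subset r hr _ := by
    obtain rfl : r = ownRecord PD i := by simpa [LocalState.initial] using hr
    exact Finset.subset_insert _ _
  owner_mem r hr _ := by
    obtain rfl : r = ownRecord PD i := by simpa [LocalState.initial] using hr
    simp [LocalState.initial, ownRecord]

theorem LocalState.pds_subset_onSetPDs (s : LocalState P) (j : P) (X : Finset (SignedPD P)) :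
    s.pds ⊆ (s.onSetPDs j X).pds := by
  unfold LocalState.onSetPDs
  split_ifs
  · exact Finset.subset_union_left
  · exact subset_rfl

theorem LocalState.Valid.onSetPDs {i : P} {s : LocalState P} (h : s.Valid PD F i) (j : P)
    {X : Finset (SignedPD P)} (hX : Unforged PD F (.setPDs X)) :
    (s.onSetPDs j X).Valid PD F i := by
  unfold LocalState.onSetPDs
  split_ifs
  · constructor
    · exact Finset.mem_union_left _ h.own
    · intro r hr
      exact (Finset.mem_union.1 hr).elim (h.unforged r) (hX r)
    · intro r hr hw
      rcases Finset.mem_union.1 hr with hr | hr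
      · exact (h.pd_subset r hr hw).trans Finset.subset_union_left
      · exact (Finset.subset_biUnion_of_mem SignedPD.pd (Finset.mem_filter.2 ⟨hr, hw⟩)).trans
          Finset.subset_union_right
    · intro r hr hw
      rcases Finset.mem_union.1 hr with hr | hr
      · exact Finset.mem_union_left _ (h.owner_mem r hr hw)
      · exact Finset.mem_union_right _
          (Finset.mem_image_of_mem SignedPD.owner (Finset.mem_filter.2 ⟨hr, hw⟩))
  · exact h

theorem LocalState.ownRecord_mem_onSetPDs (s : LocalState P) {j : P} {X : Finset (SignedPD P)}
    (hX : ownRecord PD j ∈ X) : ownRecord PD j ∈ (s.onSetPDs j X).pds := by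
  unfold LocalState.onSetPDs
  rw [if_pos ⟨ownRecord PD j, hX, rfl, rfl⟩]
  exact Finset.mem_union_right _ hX

/-- As soon as a process has the records of all members of the sink component, the sink component
is a witness. -/
theorem LocalState.Valid.isWitness [Fintype P] {i : P} {s : LocalState P} (h : s.Valid PD F i)
    (hF : F.card ≤ f) {S : Finset P} (hS : IsOSR (knowledgeGraph PD) Fᶜ (f + 1) S)
    (hrec : ∀ j ∈ S, ownRecord PD j ∈ s.pds) : s.IsWitness f S := by
  have hSF : ∀ a ∈ S, a ∉ F := fun a ha => Finset.mem_compl.1 (hS.isSink.1.2.1 ha)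
  refine ⟨fun j hj => h.owner_mem _ (hrec j hj) rfl, ?_, fun K hK => ?_⟩
  · exact (hS.sink_connected.mono (H := s.view) fun a ha b _ hab =>
      ⟨ownRecord PD a, hrec a ha, rfl, rfl, hab⟩).le_strongConnectivity
  · obtain ⟨hKS, ⟨a, ha⟩, -, hpaths⟩ := hK
    refine (Finset.card_le_card fun b hb => ?_).trans hF
    by_contra hbF
    -- A correct `b` would give `f + 1 ≤ F.card ≤ f`. Only edges out of `S` matter for the cut, so
    -- the edges that Byzantine nodes claim are harmless.
    have := (hpaths a ha b hb).le_card_of_separates ha (Finset.mem_sdiff.1 (hKS hb)).2 hbF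
      fun x hx y hy hxy => by
        by_contra hyF
        exact hy (hS.isSink.mem_of_adj hx (Finset.mem_compl.2 hyF) (h.adj_of_view (hSF x hx) hxy))
    omega

/-- The invariant of configurations. -/
def Config.Valid (PD : P → Finset P) (F : Finset P) (c : Config P) : Prop :=
  (∀ i, (c.state i).Valid PD F i) ∧ ∀ p ∈ c.net, Unforged PD F p.body

/-- The two halves of the invariant sustain each other: replies copy stored records into the
network, deliveries copy them back. States of Byzantine processes never change, so all `i` are
covered. -/
theorem Step.valid {t : ℝ} {c c' : Config P} {e : Event P} (h : Step PD F f t c e c')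
    (hc : c.Valid PD F) : c'.Valid PD F := by
  obtain ⟨hs, hn⟩ := hc
  cases h with
  | request _ i hi =>
    refine ⟨hs, fun p hp => ?_⟩
    rcases Multiset.mem_add.1 hp with hp | hp
    · exact hn p hp
    · obtain ⟨j, -, rfl⟩ := Multiset.mem_map.1 hp
      trivial
  | deliverGet σ N s j i hi =>
    refine ⟨hs, fun p hp => ?_⟩
    rcases Multiset.mem_cons.1 hp with rfl | hp
    · exact (hs i).unforged
    · exact hn p (Multiset.mem_cons_of_mem hp)
  | deliverSet σ N s j i X hi =>
    refine ⟨fun k => ?_, fun p hp => hn p (Multiset.mem_cons_of_mem hp)⟩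
    rcases eq_or_ne k i with rfl | hk
    · simpa using (hs k).onSetPDs j (hn _ (Multiset.mem_cons_self _ _))
    · simpa [hk] using hs k
  | deliverByzantine σ N p hp => exact ⟨hs, fun q hq => hn q (Multiset.mem_cons_of_mem hq)⟩
  | inject _ b j m hb hm =>
    refine ⟨hs, fun p hp => ?_⟩
    rcases Multiset.mem_cons.1 hp with rfl | hp
    · exact hm
    · exact hn p hp
  | finish _ i A hi hr hA =>
    refine ⟨fun k => ?_, hn⟩
    rcases eq_or_ne k i with rfl | hk
    · simpa using ⟨(hs k).own, (hs k).unforged, (hs k).pd_subset, (hs k).owner_mem⟩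
    · simpa [hk] using hs k

theorem Step.pds_subset {t : ℝ} {c c' : Config P} {e : Event P} (h : Step PD F f t c e c')
    (k : P) : (c.state k).pds ⊆ (c'.state k).pds := by
  cases h with
  | deliverSet σ N s j i X hi =>
    rcases eq_or_ne k i with rfl | hk
    · simpa using (σ k).pds_subset_onSetPDs j X
    · simp [hk]
  | finish _ i A hi hr hA =>
    rcases eq_or_ne k i with rfl | hk
    · simp
    · simp [hk]
  | _ => exact subset_rfl

/-- A message leaves the network only by being delivered. -/
theorem Step.eq_deliver {t : ℝ} {c c' : Config P} {e : Event P} (h : Step PD F f t c e c')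
    {p : Packet P} (hp : p ∈ c.net) (hp' : p ∉ c'.net) : e = .deliver p := by
  cases h with
  | request _ i hi => exact absurd (Multiset.mem_add.2 (.inl hp)) hp'
  | deliverGet σ N s j i hi =>
    rcases Multiset.mem_cons.1 hp with rfl | hp
    · rfl
    · exact absurd (Multiset.mem_cons_of_mem hp) hp'
  | deliverSet σ N s j i X hi =>
    rcases Multiset.mem_cons.1 hp with rfl | hp
    · rfl
    · exact absurd hp hp'
  | deliverByzantine σ N q hq =>
    rcases Multiset.mem_cons.1 hp with rfl | hp
    · rfl
    · exact absurd hp hp'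
  | inject _ b j m hb hm => exact absurd (Multiset.mem_cons_of_mem hp) hp'
  | finish _ i A hi hr hA => exact absurd hp hp'

theorem Step.mem_net_of_request {t : ℝ} {c c' : Config P} {i j : P}
    (h : Step PD F f t c (.request i) c') (hj : j ∈ (c.state i).known) :
    (⟨t, i, j, .getPDs⟩ : Packet P) ∈ c'.net := by
  cases h
  exact Multiset.mem_add.2 (.inr (Multiset.mem_map.2 ⟨j, hj, rfl⟩))

theorem Step.mem_net_of_deliver_getPDs {t s : ℝ} {c c' : Config P} {i j : P}
    (h : Step PD F f t c (.deliver ⟨s, i, j, .getPDs⟩) c') (hj : j ∉ F) :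
    (⟨t, j, i, .setPDs (c.state j).pds⟩ : Packet P) ∈ c'.net := by
  cases h with
  | deliverGet => exact Multiset.mem_cons_self _ _
  | deliverByzantine _ _ _ hp => exact absurd hp hj

theorem Step.state_of_deliver_setPDs {t s : ℝ} {c c' : Config P} {i j : P}
    {X : Finset (SignedPD P)} (h : Step PD F f t c (.deliver ⟨s, j, i, .setPDs X⟩) c')
    (hi : i ∉ F) : c'.state i = (c.state i).onSetPDs j X := by
  cases h with
  | deliverSet => simp
  | deliverByzantine _ _ _ hp => exact absurd hp hi

/-! ### Liveness of Discovery -/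

namespace Execution

variable (E : Execution PD F f)

theorem valid (n : ℕ) : (E.config n).Valid PD F := by
  induction n with
  | zero => simpa [E.start, Config.Valid] using fun i => LocalState.valid_initial i
  | succ n ih => exact (E.step n).valid ih

theorem monotone_pds (i : P) : Monotone fun n => ((E.config n).state i).pds :=
  monotone_nat_of_le_succ fun n => (E.step n).pds_subset i

/-- Messages between correct processes are delivered. -/
theorem exists_deliver {n : ℕ} {p : Packet P} (hp : p ∈ (E.config n).net) (hs : p.src ∉ F)
    (hd : p.dst ∉ F) : ∃ m ≥ n, E.event m = .deliver p := by
  by_contra! hne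
  have hmem : ∀ m ≥ n, p ∈ (E.config m).net := fun m hm => by
    induction m, hm using Nat.le_induction with
    | base => exact hp
    | succ m hm ih =>
      by_contra h
      exact hne m hm ((E.step m).eq_deliver ih h)
  obtain ⟨GST, δ, -, hδ⟩ := E.partial_synchrony
  obtain ⟨m, hm, ht⟩ := ((Filter.eventually_ge_atTop n).and
    (E.time_unbounded.eventually_gt_atTop (max p.sentAt GST + δ))).exists
  exact (hδ m p (hmem m hm) hs hd).not_gt ht

/-- A correct process sends requests at arbitrarily late moments. -/
theorem exists_request {i : P} (hi : i ∉ F) (N : ℕ) : ∃ n ≥ N, E.event n = .request i := by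
  obtain ⟨T, -, hT⟩ := E.periodic i hi
  have hN : 0 ≤ E.time N := E.time_nonneg.trans (E.time_mono N.zero_le)
  -- The `+ 1` makes the times strictly ordered, as monotonicity of `time` yields an order of
  -- indices only from a strict inequality.
  obtain ⟨n, hn, ht, -⟩ := hT (E.time N + 1) (by linarith)
  exact ⟨n, (E.time_mono.reflect_lt (by linarith)).le, hn⟩

/-- If a correct process has the record of `a`, it will have the record of every correct member of
the PD of `a`. -/
theorem exists_ownRecord_mem {i a b : P} (hi : i ∉ F) (hb : b ∉ F) (hab : b ∈ PD a) {N : ℕ}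
    (hN : ownRecord PD a ∈ ((E.config N).state i).pds) :
    ∃ n, ownRecord PD b ∈ ((E.config n).state i).pds := by
  obtain ⟨n₁, h₁, he₁⟩ := E.exists_request hi N
  have hknown : b ∈ ((E.config n₁).state i).known :=
    ((E.valid n₁).1 i).pd_subset _ (E.monotone_pds i h₁ hN) rfl hab
  have hp₁ := (he₁ ▸ E.step n₁).mem_net_of_request hknown
  obtain ⟨n₂, -, he₂⟩ := E.exists_deliver hp₁ hi hb
  have hp₂ := (he₂ ▸ E.step n₂).mem_net_of_deliver_getPDs hb
  obtain ⟨n₃, -, he₃⟩ := E.exists_deliver hp₂ hb hi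
  refine ⟨n₃ + 1, ?_⟩
  have hstep := E.step n₃
  rw [he₃] at hstep
  rw [hstep.state_of_deliver_setPDs hi]
  -- The reply holds what `b` stored at event `n₂`, including its own record, so it passes the test
  -- on receipt.
  exact LocalState.ownRecord_mem_onSetPDs _ ((E.valid n₂).1 b).own

/-- A correct process obtains the record of every process that it reaches in the safe subgraph. -/
theorem exists_ownRecord_mem_of_reachable [Fintype P] {i j : P}
    (hij : ReachableIn (knowledgeGraph PD) Fᶜ i j) :
    ∃ n, ownRecord PD j ∈ ((E.config n).state i).pds := by
  obtain ⟨l, hl⟩ := hij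
  refine hl.induction (p := fun j => ∃ n, ownRecord PD j ∈ ((E.config n).state i).pds)
    ⟨0, ((E.valid 0).1 i).own⟩ fun a _ b hb ha hab => ?_
  obtain ⟨N, hN⟩ := ha
  exact E.exists_ownRecord_mem (Finset.mem_compl.1 hl.head_mem) (Finset.mem_compl.1 hb) hab hN

end Execution

end Algorithms

end BFTCUP

theorem mainTheorem9 {P : Type*} [Fintype P] [DecidableEq P]
    (PD : P → Finset P) (F : Finset P) (f : ℕ) (hF : F.card ≤ f)
    (hG : BFTCUP.SatisfiesBFTCUP PD F f) (E : BFTCUP.Execution PD F f) :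
    ∀ i ∉ F, ∃ n A, ((E.config n).state i).result = some A := by
  intro i hi
  by_contra! hres
  obtain ⟨S, hS, -⟩ := hG
  have hrec : ∀ j ∈ S, ∃ n, BFTCUP.ownRecord PD j ∈ ((E.config n).state i).pds := fun j hj =>
    E.exists_ownRecord_mem_of_reachable (hS.reachable (Finset.mem_compl.2 hi) hj)
  choose! g hg using hrec
  -- From the latest of the moments `g j` on, all records of `S` are present.
  refine E.progress i hi ⟨S.sup g, fun n hn => ⟨?_, S, ?_⟩⟩
  · exact Option.eq_none_iff_forall_ne_some.2 (hres n)
  · exact ((E.valid n).1 i).isWitness hF hS fun j hj =>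
      E.monotone_pds i ((Finset.le_sup hj).trans hn) (hg j hj)
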